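/- Let $a<b$, let $V\subset C[a,b]$ be compact (sup norm), and for an integer $m\ge 1$ put $x_j=a+j(b-a)/m$, $j=0,\dots,m$. For $u\in C[a,b]$ let $\mathcal L_m u\in C[a,b]$ be the piecewise linear interpolant of $u$ at $x_0,\dots,x_m$, that is, $(\mathcal L_mu)(x)=u(x_j)+\frac{u(x_{j+1})-u(x_j)}{x_{j+1}-x_j}(x-x_j)$ for $x_j\le x\le x_{j+1}$. Set $$\kappa(m,V)=\sup_{u\in V}\max_{x\in[a,b]}|u(x)-(\mathcal L_mu)(x)|,\qquad W=\bigcup_{i\ge 1}\bigl(V\cup\mathcal L_i(V)\bigr).$$ Let $\boldsymbol g:\mathbb R^K\times\mathbb R\times[a,b]\to\mathbb R^K$ and $\boldsymbol s_0\in\mathbb R^K$, and let $G$ be an operator that maps each input $u\in W$ to a solution $Gu\in C([a,b];\mathbb R^K)$ of the system $\boldsymbol s'=\boldsymbol g(\boldsymbol s,u,x)$, $\boldsymbol s(a)=\boldsymbol s_0$, in the sense that $t\mapsto \boldsymbol g((Gu)(t),u(t),t)$ is integrable on $[a,b]$ and $$(Gu)(x)=\boldsymbol s_0+\int_a^x\boldsymbol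 g((Gu)(t),u(t),t)\,dt\qquad(x\in[a,b]).$$ Suppose that for some $c>0$ the function $\boldsymbol g$ is Lipschitz in $\boldsymbol s$ and in $u$ on $G(W)\times W$: for all $\boldsymbol s,\boldsymbol s_1,\boldsymbol s_2\in G(W)$, $w,w_1,w_2\in W$ and $x\in[a,b]$, $$\|\boldsymbol g(\boldsymbol s_1(x),w(x),x)-\boldsymbol g(\boldsymbol s_2(x),w(x),x)\|_2\le c\|\boldsymbol s_1(x)-\boldsymbol s_2(x)\|_2,$$ $$\|\boldsymbol g(\boldsymbol s(x),w_1(x),x)-\boldsymbol g(\boldsymbol s(x),w_2(x),x)\|_2\le c|w_1(x)-w_2(x)|.$$ Let the activation function $\sigma:\mathbb R\to\mathbb R$ be continuous and not a polynomial, or, alternatively, a Tauber–Wiener function (the linear combinations of the functions $x\mapsto\sigma(\lambda x+\theta)$, $\lambda,\theta\in\mathbb R$, are uniformly dense in every $C[\alpha,\beta]$). Then $\max_{x\in[a,b]}|u(x)-(\mathcal L_mu)(x)|\le\kappa(m,V)<\infty$ for all $u\in V$ and $m\ge1$, and $\kappa(m,V)\to0$ as $m\to\infty$. Moreover, if $\varepsilon\in\mathbb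 R$ and the positive integer $m$ satisfy $$c(b-a)\,\kappa(m,V)\,e^{c(b-a)}<\varepsilon,$$ then for every $d\in[a,b]$ there exist an integer $n\ge1$, $\mathcal W_1\in\mathbb R^{n\times(m+1)}$, $b_1\in\mathbb R^{n}$, $\mathcal W_2\in\mathbb R^{K\times n}$ and $b_2\in\mathbb R^K$ such that $$\bigl\|(Gu)(d)-\bigl(\mathcal W_2\,\sigma(\mathcal W_1[u(x_0),\dots,u(x_m)]^{T}+b_1)+b_2\bigr)\bigr\|_2<\varepsilon\qquad\text{for all }u\in V,$$ where $\sigma$ acts componentwise. -/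

import Mathlib

open Set Filter Topology MeasureTheory

namespace SensorODE

noncomputable section

/-- The `j`-th of the `m + 1` equispaced sensors `x_j = a + j (b - a) / m` of `[a, b]`. -/
def node {a b : ℝ} (hab : a < b) (m : ℕ) (j : Fin (m + 1)) : Icc a b :=
  ⟨a + (j : ℝ) * (b - a) / m, by
    have h0 : 0 ≤ b - a := by linarith
    have hj : (j : ℝ) ≤ m := by exact_mod_cast Nat.lt_succ_iff.mp j.2
    constructor
    · have : 0 ≤ (j : ℝ) * (b - a) / m := by positivity
      linarith
    · have : (j : ℝ) * (b - a) / m ≤ b - a :=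
        div_le_of_le_mul₀ (by positivity) h0 (by nlinarith)
      linarith⟩

/-- The piecewise linear interpolant `u_m` of `u` at the sensors `x_0, …, x_m`, as an element of
`C[a, b]`.  It is written as `u(x_0)` plus the sum of the increments over the subintervals: the
`j`-th increment is the slope on `[x_j, x_{j+1}]` times the length of `[x_j, x_{j+1}]` to the left
of `x`.  The usual formula on each subinterval is `interp_apply` below. -/
def interp {a b : ℝ} (hab : a < b) (m : ℕ) (u : C(Icc a b, ℝ)) : C(Icc a b, ℝ) where
  toFun x := u (node hab m 0) + ∑ j : Fin m,
    (u (node hab m j.succ) - u (node hab m j.castSucc)) /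
        ((node hab m j.succ : ℝ) - (node hab m j.castSucc : ℝ)) *
      (max (node hab m j.castSucc : ℝ) (min (x : ℝ) (node hab m j.succ : ℝ)) -
        (node hab m j.castSucc : ℝ))
  continuous_toFun := by fun_prop

theorem node_mono {a b : ℝ} (hab : a < b) (m : ℕ) {i j : Fin (m + 1)} (h : i ≤ j) :
    (node hab m i : ℝ) ≤ (node hab m j : ℝ) := by
  have h0 : 0 ≤ b - a := by linarith
  have hij : (i : ℝ) ≤ (j : ℝ) := by exact_mod_cast h
  simp only [node]
  gcongr

theorem node_lt {a b : ℝ} (hab : a < b) {m : ℕ} (j : Fin m) :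
    (node hab m j.castSucc : ℝ) < (node hab m j.succ : ℝ) := by
  have h0 : 0 < b - a := by linarith
  have hm : (0 : ℝ) < m := by exact_mod_cast j.pos
  simp only [node, Fin.val_castSucc, Fin.val_succ]
  push_cast
  gcongr
  linarith

/-- On `[x_k, x_{k+1}]` the interpolant is
`u(x_k) + (u(x_{k+1}) - u(x_k)) / (x_{k+1} - x_k) * (x - x_k)`. -/
theorem interp_apply {a b : ℝ} (hab : a < b) (m : ℕ) (u : C(Icc a b, ℝ)) (k : Fin m)
    (x : Icc a b) (h1 : (node hab m k.castSucc : ℝ) ≤ x) (h2 : (x : ℝ) ≤ node hab m k.succ) :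
    interp hab m u x = u (node hab m k.castSucc) +
      (u (node hab m k.succ) - u (node hab m k.castSucc)) /
        ((node hab m k.succ : ℝ) - (node hab m k.castSucc : ℝ)) *
        ((x : ℝ) - (node hab m k.castSucc : ℝ)) := by
  set X : ℝ := (u (node hab m k.succ) - u (node hab m k.castSucc)) /
        ((node hab m k.succ : ℝ) - (node hab m k.castSucc : ℝ)) *
        ((x : ℝ) - (node hab m k.castSucc : ℝ)) with hX
  let f : ℕ → ℝ := fun i => if h : i < m + 1 then u (node hab m ⟨i, h⟩) else 0
  let T : ℕ → ℝ := fun i => if i < k then f (i + 1) - f i else if i = k then X else 0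
  have hf : ∀ j : Fin (m + 1), f j = u (node hab m j) := fun j => dif_pos j.2
  have hT : interp hab m u x = f 0 + ∑ j : Fin m, T j := by
    have h0 : f 0 = u (node hab m 0) := hf 0
    rw [h0]
    simp only [interp, ContinuousMap.coe_mk]
    congr 1
    refine Finset.sum_congr rfl fun j _ => ?_
    have hlt := node_lt hab j
    rcases lt_trichotomy j k with hjk | hjk | hjk
    · have hn : (node hab m j.succ : ℝ) ≤ x :=
        (node_mono hab m (show j.succ ≤ k.castSucc from hjk)).trans h1
      have e : T j = u (node hab m j.succ) - u (node hab m j.castSucc) := by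
        have e1 : f ((j : ℕ) + 1) = u (node hab m j.succ) := hf j.succ
        have e2 : f (j : ℕ) = u (node hab m j.castSucc) := hf j.castSucc
        have hjk' : (j : ℕ) < k := hjk
        simp only [T, hjk', if_true, e1, e2]
      rw [e, min_eq_right hn, max_eq_right hlt.le, div_mul_cancel₀ _ (sub_pos.2 hlt).ne']
    · subst hjk
      simp only [T, lt_irrefl, if_false, if_true, hX]
      rw [min_eq_left h2, max_eq_right h1]
    · have hn : (x : ℝ) ≤ node hab m j.castSucc :=
        h2.trans (node_mono hab m (show k.succ ≤ j.castSucc from hjk))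
      have hjk' : (k : ℕ) < j := hjk
      have e : T j = 0 := by simp [T, hjk'.not_gt, hjk'.ne']
      rw [e, min_eq_left (hn.trans hlt.le), max_eq_left hn, sub_self, mul_zero]
  have hs : ∑ j : Fin m, T j = ∑ i ∈ Finset.range (k + 1), T i := by
    rw [Fin.sum_univ_eq_sum_range T m]
    symm
    apply Finset.sum_subset
    · intro i hi
      have := k.2
      simp only [Finset.mem_range] at hi ⊢
      omega
    · intro i _ hi
      have hi' : (k : ℕ) < i := by
        simp only [Finset.mem_range] at hi
        omega
      simp [T, hi'.not_gt, hi'.ne']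
  have hr : ∑ i ∈ Finset.range k, T i = f k - f 0 := by
    rw [← Finset.sum_range_sub]
    refine Finset.sum_congr rfl fun i hi => ?_
    simp [T, Finset.mem_range.1 hi]
  have hk : f k = u (node hab m k.castSucc) := hf k.castSucc
  have hTk : T k = X := by simp [T]
  rw [hT, hs, Finset.sum_range_succ, hr, hTk, hk]
  ring

/-- The largest error of piecewise linear interpolation at `m + 1` equispaced sensors over the set
`V` of inputs, in the sup norm of `C[a, b]`. -/
def kappa {a b : ℝ} (hab : a < b) (V : Set C(Icc a b, ℝ)) (m : ℕ) : ℝ :=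
  sSup ((fun u => ‖u - interp hab m u‖) '' V)

/-- The set `W` of all inputs in `V` and all their piecewise linear interpolants at `i + 1`
equispaced sensors, `i = 1, 2, …`. -/
def extendedInputs {a b : ℝ} (hab : a < b) (V : Set C(Icc a b, ℝ)) : Set C(Icc a b, ℝ) :=
  ⋃ (i : ℕ) (_ : 1 ≤ i), (V ∪ interp hab i '' V)

/-- `s` solves `s' = g(s, u, x)`, `s(a) = s₀` on `[a, b]` with input `u`, in the integral form
`s(x) = s₀ + ∫_a^x g(s(t), u(t), t) dt`, the integrand being integrable.  (`IccExtend` only turns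
the integrand, a function on `[a, b]`, into one on `ℝ`.) -/
def IsSolution {a b : ℝ} (hab : a < b) {K : ℕ}
    (g : EuclideanSpace ℝ (Fin K) → ℝ → ℝ → EuclideanSpace ℝ (Fin K))
    (s₀ : EuclideanSpace ℝ (Fin K)) (u : C(Icc a b, ℝ))
    (s : C(Icc a b, EuclideanSpace ℝ (Fin K))) : Prop :=
  IntervalIntegrable (IccExtend hab.le fun t : Icc a b => g (s t) (u t) t) volume a b ∧
  ∀ x : Icc a b,
    s x = s₀ + ∫ t in a..(x : ℝ), IccExtend hab.le (fun t : Icc a b => g (s t) (u t) t) t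

/-- Tauber-Wiener functions: the linear combinations of `x ↦ σ(λ x + θ)` are uniformly dense in
every `C[α, β]`. -/
def IsTauberWiener (σ : ℝ → ℝ) : Prop :=
  ∀ α β : ℝ, α < β → ∀ f : ℝ → ℝ, ContinuousOn f (Icc α β) → ∀ ε : ℝ, 0 < ε →
    ∃ (N : ℕ) (c l θ : Fin N → ℝ),
      ∀ x ∈ Icc α β, |f x - ∑ i, c i * σ (l i * x + θ i)| < ε

/-- The output `W₂ · σ(W₁ · v + b₁) + b₂` of a network with one hidden layer of `n` neurons, with
`σ` acting componentwise. -/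
def network {p n K : ℕ} (σ : ℝ → ℝ) (W₁ : Matrix (Fin n) (Fin p) ℝ) (b₁ : Fin n → ℝ)
    (W₂ : Matrix (Fin K) (Fin n) ℝ) (b₂ : Fin K → ℝ) (v : Fin p → ℝ) :
    EuclideanSpace ℝ (Fin K) :=
  WithLp.toLp 2 (W₂.mulVec (fun i => σ ((W₁.mulVec v + b₁) i)) + b₂)

end

end SensorODE

namespace SensorODE

/-! By Grönwall, `G` is Lipschitz on `W` with constant `c (b - a) exp (c (b - a))`
(`norm_solution_sub_solution_le`). Replacing `u` by its interpolant therefore costs at most `c (b -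
a) κ exp (c (b - a)) < ε`. The interpolant depends only on the sensor values, and does so without
expanding distances. So its solution at `d` is a continuous function of the sensor vector on a
compact set, and a network approximates it within the remaining tolerance (`exists_network_near`).
Compactness of `V` gives equicontinuity, hence `κ → 0`.

A continuous non-polynomial `σ` is Tauber–Wiener: by Fréchet's theorem some `k`-th difference of `σ`
is nonzero at some point. Differentiating averaged ridge functions in the weight `k` times then puts
`x ^ k` in their closed span, and Weierstrass finishes. Several variables reduce to one through
exponentials of linear forms, which span an algebra dense by Stone–Weierstrass. -/

/-! ### Piecewise linear interpolation and the error `κ`. -/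

theorem exists_cell {a b : ℝ} (hab : a < b) {m : ℕ} (hm : 0 < m) (x : Icc a b) :
    ∃ k : Fin m, (node hab m k.castSucc : ℝ) ≤ x ∧ (x : ℝ) ≤ node hab m k.succ := by
  have key : ∀ j : ℕ, j < m → (x : ℝ) ≤ a + ((j + 1 : ℕ) : ℝ) * (b - a) / m →
      ∃ k : Fin m, (node hab m k.castSucc : ℝ) ≤ x ∧ (x : ℝ) ≤ node hab m k.succ := by
    intro j
    induction j with
    | zero =>
      intro hj hx
      refine ⟨⟨0, hj⟩, ?_, ?_⟩
      · simpa [node] using x.2.1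
      · simpa [node] using hx
    | succ j ih =>
      intro hj hx
      by_cases h : (x : ℝ) ≤ a + ((j + 1 : ℕ) : ℝ) * (b - a) / m
      · exact ih (by omega) h
      · refine ⟨⟨j + 1, hj⟩, ?_, ?_⟩
        · simpa [node] using (not_le.1 h).le
        · simpa [node] using hx
  refine key (m - 1) (by omega) ?_
  have hm' : (m : ℝ) ≠ 0 := by positivity
  rw [Nat.sub_add_cancel hm, mul_div_assoc, mul_div_cancel₀ _ hm']
  linarith [x.2.2]

/-- The value of the interpolant at a point is a convex combination of the values of the input at
the two ends of a cell that contains the point. -/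
theorem exists_interp_eq_convexComb {a b : ℝ} (hab : a < b) {m : ℕ} (hm : 0 < m) (x : Icc a b) :
    ∃ (i j : Fin (m + 1)) (t : ℝ), 0 ≤ t ∧ t ≤ 1 ∧
      dist x (node hab m i) ≤ (b - a) / m ∧ dist x (node hab m j) ≤ (b - a) / m ∧
      ∀ u : C(Icc a b, ℝ),
        interp hab m u x = (1 - t) * u (node hab m i) + t * u (node hab m j) := by
  obtain ⟨k, h1, h2⟩ := exists_cell hab hm x
  have hlt := node_lt hab k
  have hlen : (node hab m k.succ : ℝ) - node hab m k.castSucc = (b - a) / m := by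
    simp only [node, Fin.val_castSucc, Fin.val_succ]
    push_cast
    ring
  refine ⟨k.castSucc, k.succ, ((x : ℝ) - node hab m k.castSucc) /
    ((node hab m k.succ : ℝ) - node hab m k.castSucc), ?_, ?_, ?_, ?_, fun u => ?_⟩
  · exact div_nonneg (by linarith) (by linarith)
  · exact div_le_one_of_le₀ (by linarith) (by linarith)
  · rw [Subtype.dist_eq, Real.dist_eq, abs_le]
    constructor <;> linarith
  · rw [Subtype.dist_eq, Real.dist_eq, abs_le]
    constructor <;> linarith
  · rw [interp_apply hab m u k x h1 h2]
    ring

theorem abs_convexComb_le {t p q r : ℝ} (h0 : 0 ≤ t) (h1 : t ≤ 1) (hp : |p| ≤ r) (hq : |q| ≤ r) :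
    |(1 - t) * p + t * q| ≤ r := by
  rw [abs_le] at *
  constructor <;> nlinarith

/-- The cell and the weight `t` at `x` do not depend on the input, so the difference is a convex
combination of nodal differences. The case `r = 0` says that the interpolant is determined by the
sensor values. -/
theorem norm_interp_sub_interp_le {a b : ℝ} (hab : a < b) {m : ℕ} (hm : 0 < m)
    (u v : C(Icc a b, ℝ)) {r : ℝ}
    (h : ∀ j, |u (node hab m j) - v (node hab m j)| ≤ r) :
    ‖interp hab m u - interp hab m v‖ ≤ r := by
  refine (ContinuousMap.norm_le _ ((abs_nonneg _).trans (h 0))).2 fun x => ?_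
  obtain ⟨i, j, t, h0, h1, -, -, he⟩ := exists_interp_eq_convexComb hab hm x
  rw [ContinuousMap.sub_apply, he, he, Real.norm_eq_abs]
  convert abs_convexComb_le h0 h1 (h i) (h j) using 2
  ring

/-- The weights sum to one, so the error at `x` is a convex combination of the differences between
`u x` and two nodal values, taken within one mesh width of `x`. -/
theorem norm_sub_interp_le {a b : ℝ} (hab : a < b) {m : ℕ} (hm : 0 < m)
    (u : C(Icc a b, ℝ)) {r : ℝ}
    (h : ∀ x y : Icc a b, dist x y ≤ (b - a) / m → |u x - u y| ≤ r) :
    ‖u - interp hab m u‖ ≤ r := by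
  have hr : 0 ≤ r := (abs_nonneg _).trans (h (node hab m 0) (node hab m 0) (by
    rw [dist_self]
    exact div_nonneg (by linarith) (Nat.cast_nonneg _)))
  refine (ContinuousMap.norm_le _ hr).2 fun x => ?_
  obtain ⟨i, j, t, h0, h1, hi, hj, he⟩ := exists_interp_eq_convexComb hab hm x
  rw [ContinuousMap.sub_apply, he, Real.norm_eq_abs]
  convert abs_convexComb_le h0 h1 (h x _ hi) (h x _ hj) using 2
  ring

theorem norm_sub_interp_le_kappa {a b : ℝ} (hab : a < b) {V : Set C(Icc a b, ℝ)}
    (hV : IsCompact V) {m : ℕ} (hm : 0 < m) {u : C(Icc a b, ℝ)} (hu : u ∈ V) :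
    ‖u - interp hab m u‖ ≤ kappa hab V m := by
  -- The supremum means something only for a bounded set of errors; a common norm bound `C` on `V`
  -- gives `2 * C`.
  refine le_csSup ?_ (mem_image_of_mem _ hu)
  obtain ⟨C, hC⟩ := hV.isBounded.exists_norm_le
  refine ⟨2 * C, ?_⟩
  rintro _ ⟨v, hv, rfl⟩
  refine norm_sub_interp_le hab hm v fun x y _ => ?_
  have hx := (v.norm_coe_le_norm x).trans (hC v hv)
  have hy := (v.norm_coe_le_norm y).trans (hC v hv)
  rw [Real.norm_eq_abs, abs_le] at hx hy
  rw [abs_le]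
  constructor <;> linarith

theorem kappa_nonneg {a b : ℝ} (hab : a < b) (V : Set C(Icc a b, ℝ)) (m : ℕ) :
    0 ≤ kappa hab V m := by
  refine Real.sSup_nonneg ?_
  rintro _ ⟨u, -, rfl⟩
  exact norm_nonneg _

/-- Evaluation is uniformly continuous on the compact set `V ×ˢ univ`, which yields one modulus of
continuity for all of `V`. -/
theorem tendsto_kappa {a b : ℝ} (hab : a < b) {V : Set C(Icc a b, ℝ)} (hV : IsCompact V) :
    Tendsto (kappa hab V) atTop (𝓝 0) := by
  have huc : UniformContinuousOn (fun p : C(Icc a b, ℝ) × Icc a b => p.1 p.2) (V ×ˢ univ) :=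
    (hV.prod isCompact_univ).uniformContinuousOn_of_continuous (by fun_prop)
  rw [Metric.uniformContinuousOn_iff] at huc
  rw [Metric.tendsto_atTop]
  intro ε hε
  obtain ⟨δ, hδ, H⟩ := huc (ε / 2) (half_pos hε)
  obtain ⟨N, hN⟩ := exists_nat_gt ((b - a) / δ)
  refine ⟨N + 1, fun m hm => ?_⟩
  have hm0 : (0 : ℝ) < m := by exact_mod_cast (show 0 < m by omega)
  have hmN : (N : ℝ) ≤ m := by exact_mod_cast (show N ≤ m by omega)
  have hlen : (b - a) / m < δ := by
    rw [div_lt_iff₀ hδ] at hN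
    rw [div_lt_iff₀ hm0]
    nlinarith
  rw [Real.dist_eq, sub_zero, abs_of_nonneg (kappa_nonneg hab V m)]
  -- A supremum may lose strictness, hence `ε / 2`.
  refine lt_of_le_of_lt (Real.sSup_le ?_ (half_pos hε).le) (half_lt_self hε)
  rintro _ ⟨u, hu, rfl⟩
  refine norm_sub_interp_le hab (by omega) u fun x y hxy => ?_
  have := H (u, x) ⟨hu, mem_univ _⟩ (u, y) ⟨hu, mem_univ _⟩ (by
    rw [Prod.dist_eq, dist_self]
    exact max_lt hδ (hxy.trans_lt hlen))
  exact this.le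

/-! ### Grönwall's inequality and stability of solutions. -/

/-- Grönwall's inequality in integral form, for a continuous function. -/
theorem le_mul_exp_of_le_add_integral {f : ℝ → ℝ} (hf : Continuous f) {a b c δ : ℝ} (hc : 0 ≤ c)
    (h : ∀ x ∈ Icc a b, f x ≤ δ + c * ∫ t in a..x, f t) {x : ℝ} (hx : x ∈ Icc a b) :
    f x ≤ δ * Real.exp (c * (x - a)) := by
  -- Since `F' = c f ≤ c F` on the interior, `F` times `exp (-c (x - a))` decreases from its initial
  -- value `δ`.
  let F : ℝ → ℝ := fun x => δ + c * ∫ t in a..x, f t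
  have hF : ∀ y, HasDerivAt F (c * f y) y := fun y =>
    ((hf.integral_hasStrictDerivAt a y).hasDerivAt.const_mul c).const_add δ
  have hE : ∀ y, HasDerivAt (fun z => Real.exp (-(c * (z - a))))
      (Real.exp (-(c * (y - a))) * -(c * 1)) y := fun y =>
    ((((hasDerivAt_id y).sub_const a).const_mul c).neg).exp
  have hH := fun y => (hF y).mul (hE y)
  have hanti : AntitoneOn (F * fun z => Real.exp (-(c * (z - a)))) (Icc a b) := by
    refine antitoneOn_of_deriv_nonpos (convex_Icc a b)
      (fun y _ => (hH y).continuousAt.continuousWithinAt)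
      (fun y _ => (hH y).differentiableAt.differentiableWithinAt) fun y hy => ?_
    rw [interior_Icc] at hy
    rw [(hH y).deriv]
    have h1 : f y ≤ F y := h y (Ioo_subset_Icc_self hy)
    have h2 := Real.exp_pos (-(c * (y - a)))
    have h3 : 0 ≤ c * Real.exp (-(c * (y - a))) * (F y - f y) :=
      mul_nonneg (mul_nonneg hc h2.le) (sub_nonneg.2 h1)
    linarith
  have h1 := hanti (left_mem_Icc.2 (hx.1.trans hx.2)) hx hx.1
  simp only [Pi.mul_apply, F, intervalIntegral.integral_same, mul_zero, add_zero, sub_self,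
    neg_zero, Real.exp_zero, mul_one] at h1
  rw [Real.exp_neg, mul_inv_le_iff₀ (Real.exp_pos _)] at h1
  exact (h x hx).trans h1

/-- Stability of the solution operator with respect to the input. -/
theorem norm_solution_sub_solution_le {a b : ℝ} (hab : a < b) {K : ℕ}
    {g : EuclideanSpace ℝ (Fin K) → ℝ → ℝ → EuclideanSpace ℝ (Fin K)}
    {s₀ : EuclideanSpace ℝ (Fin K)} {w₁ w₂ : C(Icc a b, ℝ)}
    {s₁ s₂ : C(Icc a b, EuclideanSpace ℝ (Fin K))}
    (h₁ : IsSolution hab g s₀ w₁ s₁) (h₂ : IsSolution hab g s₀ w₂ s₂) {c : ℝ} (hc : 0 < c)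
    (hs : ∀ x : Icc a b, ‖g (s₁ x) (w₁ x) x - g (s₂ x) (w₁ x) x‖ ≤ c * ‖s₁ x - s₂ x‖)
    (hw : ∀ x : Icc a b, ‖g (s₂ x) (w₁ x) x - g (s₂ x) (w₂ x) x‖ ≤ c * |w₁ x - w₂ x|)
    (d : Icc a b) :
    ‖s₁ d - s₂ d‖ ≤ c * (b - a) * ‖w₁ - w₂‖ * Real.exp (c * (b - a)) := by
  set η := ‖w₁ - w₂‖ with hη
  have hη0 : 0 ≤ η := norm_nonneg _
  -- The constant extension beyond `[a, b]` supplies the continuity on all of `ℝ` used in Grönwall's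
  -- inequality.
  set f : ℝ → ℝ := IccExtend hab.le fun t : Icc a b => ‖s₁ t - s₂ t‖ with hfdef
  have hf : Continuous f := Continuous.Icc_extend' (by fun_prop)
  have hfx : ∀ x : Icc a b, f x = ‖s₁ x - s₂ x‖ := fun x => IccExtend_val _ _ x
  have hle : ∀ x ∈ Icc a b, f x ≤ c * (b - a) * η + c * ∫ t in a..x, f t := by
    intro x hx
    have hsub : uIcc a x ⊆ uIcc a b := by
      rw [uIcc_of_le hx.1, uIcc_of_le hab.le]
      exact Icc_subset_Icc_right hx.2
    have i₁ := h₁.1.mono_set hsub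
    have i₂ := h₂.1.mono_set hsub
    have e := hfx ⟨x, hx⟩
    simp only at e
    rw [e, h₁.2, h₂.2, add_sub_add_left_eq_sub, ← intervalIntegral.integral_sub i₁ i₂]
    refine (intervalIntegral.norm_integral_le_of_norm_le (g := fun t => c * f t + c * η) hx.1
      (Eventually.of_forall fun t ht => ?_)
      (Continuous.intervalIntegrable (by fun_prop) _ _)).trans ?_
    · have ht' : t ∈ Icc a b := ⟨ht.1.le, ht.2.trans hx.2⟩
      rw [IccExtend_of_mem _ _ ht', IccExtend_of_mem _ _ ht', hfdef, IccExtend_of_mem _ _ ht']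
      have hu : |w₁ ⟨t, ht'⟩ - w₂ ⟨t, ht'⟩| ≤ η := (w₁ - w₂).norm_coe_le_norm ⟨t, ht'⟩
      -- The mixed term `g (s₂, w₁, t)` changes one argument at a time.
      calc _ ≤ _ + _ := norm_sub_le_norm_sub_add_norm_sub _ (g (s₂ ⟨t, ht'⟩) (w₁ ⟨t, ht'⟩) t) _
        _ ≤ _ := add_le_add (hs ⟨t, ht'⟩)
          ((hw ⟨t, ht'⟩).trans (mul_le_mul_of_nonneg_left hu hc.le))
    · rw [intervalIntegral.integral_add (Continuous.intervalIntegrable (by fun_prop) _ _)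
        (Continuous.intervalIntegrable (by fun_prop) _ _), intervalIntegral.integral_const_mul,
        intervalIntegral.integral_const, smul_eq_mul]
      have : (x - a) * (c * η) ≤ (b - a) * (c * η) :=
        mul_le_mul_of_nonneg_right (by linarith [hx.2]) (mul_nonneg hc.le hη0)
      linarith
  have := le_mul_exp_of_le_add_integral hf hc.le hle d.2
  rw [hfx] at this
  refine this.trans (mul_le_mul_of_nonneg_left (Real.exp_le_exp.2 ?_) ?_)
  · exact mul_le_mul_of_nonneg_left (by linarith [d.2.2]) hc.le
  · exact mul_nonneg (mul_nonneg hc.le (by linarith)) hη0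

/-! ### Fréchet's theorem on vanishing differences. -/

open Polynomial in
/-- Along an arithmetic progression, a function whose `k`-th differences vanish agrees with a
polynomial of degree less than `k`. -/
theorem exists_polynomial_on_progression {f : ℝ → ℝ} {k : ℕ} {h : ℝ} (hf : (fwdDiff h)^[k] f = 0)
    (y : ℝ) : ∃ q : ℝ[X], q.degree < k ∧ ∀ n : ℕ, f (y + n * h) = q.eval (n : ℝ) := by
  have hvan : ∀ j, k ≤ j → (fwdDiff h)^[j] f y = 0 := by
    intro j hj
    obtain ⟨i, rfl⟩ := Nat.exists_eq_add_of_le' hj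
    rw [Function.iterate_add_apply, hf]
    have : ∀ i : ℕ, (fwdDiff h)^[i] (0 : ℝ → ℝ) = 0 := fun i => by
      rw [← fwdDiff_aux.coe_fwdDiffₗ_pow, map_zero]
    rw [this, Pi.zero_apply]
  -- Newton's forward difference formula, with binomial coefficients written as polynomials in `n`.
  refine ⟨∑ j ∈ Finset.range k,
    C ((fwdDiff h)^[j] f y / (j.factorial : ℝ)) * descPochhammer ℝ j, ?_, fun n => ?_⟩
  · rw [← mem_degreeLT]
    refine Submodule.sum_mem _ fun j hj => ?_
    rw [mem_degreeLT]
    refine degree_le_natDegree.trans_lt ?_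
    have := natDegree_C_mul_le ((fwdDiff h)^[j] f y / (j.factorial : ℝ)) (descPochhammer ℝ j)
    rw [descPochhammer_natDegree] at this
    exact_mod_cast this.trans_lt (Finset.mem_range.1 hj)
  · have hN := shift_eq_sum_fwdDiff_iter h f n y
    rw [nsmul_eq_mul] at hN
    rw [hN, eval_finsetSum]
    -- Both sums extend to this range: binomials vanish for `j > n`, differences for `j ≥ k`.
    trans ∑ j ∈ Finset.range (max k (n + 1)), n.choose j • (fwdDiff h)^[j] f y
    · refine Finset.sum_subset (Finset.range_subset_range.2 (le_max_right _ _)) fun j _ hj => ?_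
      rw [Nat.choose_eq_zero_of_lt (by simpa using hj), zero_smul]
    · symm
      refine (Finset.sum_congr rfl fun j _ => ?_).trans
        (Finset.sum_subset (Finset.range_subset_range.2 (le_max_left _ _)) fun j _ hj => ?_)
      · rw [eval_mul, eval_C, nsmul_eq_mul, Nat.cast_choose_eq_descPochhammer_div ℝ n j]
        ring
      · rw [hvan j (by simpa using hj), smul_zero]

open Polynomial in
/-- Fréchet's theorem: a continuous function all of whose `k`-th differences vanish is a
polynomial. -/
theorem exists_polynomial_of_fwdDiff_iter_eq_zero {f : ℝ → ℝ} (hc : Continuous f) {k : ℕ}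
    (hf : ∀ h : ℝ, (fwdDiff h)^[k] f = 0) : ∃ p : ℝ[X], ∀ x, f x = p.eval x := by
  have hinj : Set.InjOn (fun i : ℕ => (i : ℝ)) (Finset.range k) :=
    Nat.cast_injective.injOn
  let p : ℝ[X] := Lagrange.interpolate (Finset.range k) (fun i : ℕ => (i : ℝ)) fun i => f i
  have hpd : p.degree < k := by
    have := Lagrange.degree_interpolate_lt (fun i : ℕ => f i) hinj
    rwa [Finset.card_range] at this
  have hp : ∀ i < k, f i = p.eval (i : ℝ) := fun i hi =>
    (Lagrange.eval_interpolate_at_node (fun i : ℕ => f i) hinj (Finset.mem_range.2 hi)).symm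
  -- On the grid of step `1 / N` from `-M`, `f` is a polynomial of degree less than `k` in the
  -- index. The points `0, …, k - 1` lie on it, at the indices `(M + i) * N`, and there `f` agrees
  -- with `p`; so the two polynomials coincide.
  have hgrid : ∀ (N M n : ℕ), 0 < N → f (-(M : ℝ) + n * (1 / N)) =
      p.eval (-(M : ℝ) + n * (1 / N)) := by
    intro N M n hN
    have hN0 : (N : ℝ) ≠ 0 := by positivity
    obtain ⟨q, hqd, hq⟩ := exists_polynomial_on_progression (hf (1 / (N : ℝ))) (-(M : ℝ))
    let r : ℝ[X] := p.comp (C (1 / (N : ℝ)) * X + C (-(M : ℝ)))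
    have hr : ∀ x : ℝ, r.eval x = p.eval (-(M : ℝ) + x * (1 / N)) := fun x => by
      simp only [r, eval_comp, eval_add, eval_mul, eval_C, eval_X]
      congr 1
      ring
    have hrd : r.degree < k := by
      by_cases hp0 : p = 0
      · simp only [r, hp0, zero_comp, degree_zero]
        exact WithBot.bot_lt_coe k
      · refine degree_le_natDegree.trans_lt ?_
        have h1 : r.natDegree ≤ p.natDegree := by
          refine natDegree_comp_le.trans ?_
          have := natDegree_linear_le (a := 1 / (N : ℝ)) (b := -(M : ℝ))
          nlinarith
        exact_mod_cast h1.trans_lt ((natDegree_lt_iff_degree_lt hp0).2 hpd)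
    have hqr : q = r := by
      refine eq_of_degrees_lt_of_eval_index_eq (Finset.range k)
        (v := fun i : ℕ => (((M + i) * N : ℕ) : ℝ)) ?_ (by simpa using hqd) (by simpa using hrd) ?_
      · intro i _ j _ hij
        have hij' : (M + i) * N = (M + j) * N := Nat.cast_injective hij
        have := Nat.eq_of_mul_eq_mul_right hN hij'
        omega
      · intro i hi
        have e : (-(M : ℝ) + (((M + i) * N : ℕ) : ℝ) * (1 / N)) = i := by
          push_cast
          field_simp
          ring
        rw [← hq, hr, e, hp i (Finset.mem_range.1 hi)]
    rw [hq n, hqr, hr]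
  suffices f = fun x => p.eval x from ⟨p, fun x => congrFun this x⟩
  refine (Rat.denseRange_cast (𝕜 := ℝ)).equalizer hc p.continuous (funext fun z => ?_)
  -- The grid of step `1 / den` from `-|num|` contains `z`, at the nonnegative index `|num| * den +
  -- num`.
  have hz := hgrid z.den z.num.natAbs (z.num.natAbs * z.den + z.num).toNat z.pos
  have hd0 : (z.den : ℝ) ≠ 0 := by exact_mod_cast z.den_ne_zero
  have hnn : 0 ≤ (z.num.natAbs : ℤ) * z.den + z.num := by
    have h1 : (1 : ℤ) ≤ z.den := by exact_mod_cast z.pos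
    have h2 : -z.num ≤ (z.num.natAbs : ℤ) := by omega
    have h3 : (0 : ℤ) ≤ z.num.natAbs := by omega
    nlinarith
  have hcast : (((z.num.natAbs * z.den + z.num).toNat : ℕ) : ℝ) =
      (z.num.natAbs : ℝ) * z.den + z.num := by
    rw [← Int.cast_natCast, Int.toNat_of_nonneg hnn]
    push_cast
    rw [Nat.cast_natAbs, Int.cast_abs]
  have e : (-(z.num.natAbs : ℝ) +
      (((z.num.natAbs * z.den + z.num).toNat : ℕ) : ℝ) * (1 / z.den)) = (z : ℝ) := by
    rw [hcast, Rat.cast_def z]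
    field_simp
    ring
  rwa [e] at hz

/-! ### Closed spans of ridge functions and the Tauber–Wiener property. -/

/-- A closed subspace is complete, so the integral can be taken inside it, and the inclusion
commutes with integration. -/
theorem intervalIntegral_mem_of_isClosed {E : Type*} [NormedAddCommGroup E] [NormedSpace ℝ E]
    [CompleteSpace E] {S : Submodule ℝ E} (hS : IsClosed (S : Set E)) {F : ℝ → E}
    (hF : Continuous F) (hmem : ∀ t, F t ∈ S) (a b : ℝ) : (∫ t in a..b, F t) ∈ S := by
  have : CompleteSpace S := hS.completeSpace_coe
  have hF' : Continuous fun t => (⟨F t, hmem t⟩ : S) := hF.subtype_mk hmem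
  have h := S.subtypeL.intervalIntegral_comp_comm (hF'.intervalIntegrable (μ := volume) a b)
  simp only [Submodule.subtypeL_apply] at h
  rw [h]
  exact Submodule.coe_mem _

/-- A derivative of a curve that stays in a closed subspace lies in that subspace. -/
theorem hasDerivAt_mem_of_isClosed {E : Type*} [NormedAddCommGroup E] [NormedSpace ℝ E]
    {S : Submodule ℝ E} (hS : IsClosed (S : Set E)) {F : ℝ → E} {F' : E} {x : ℝ}
    (hF : HasDerivAt F F' x) (hmem : ∀ t, F t ∈ S) : F' ∈ S := by
  rw [hasDerivAt_iff_tendsto_slope] at hF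
  refine hS.mem_of_tendsto hF (Eventually.of_forall fun y => ?_)
  rw [slope_def_module]
  exact S.smul_mem _ (S.sub_mem (hmem _) (hmem _))

/-- The function `x ↦ x ^ j * f (l * x + θ)` on `[α, β]`. -/
noncomputable def ridge (α β : ℝ) (j : ℕ) {f : ℝ → ℝ} (hf : Continuous f) (l θ : ℝ) :
    C(Icc α β, ℝ) :=
  ⟨fun x => (x : ℝ) ^ j * f (l * x + θ), by fun_prop⟩

theorem ridge_apply {α β : ℝ} (j : ℕ) {f : ℝ → ℝ} (hf : Continuous f) (l θ : ℝ) (x : Icc α β) :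
    ridge α β j hf l θ x = (x : ℝ) ^ j * f (l * x + θ) := rfl

theorem continuous_ridge {α β : ℝ} (j : ℕ) {f : ℝ → ℝ} (hf : Continuous f) {l θ : ℝ → ℝ}
    (hl : Continuous l) (hθ : Continuous θ) :
    Continuous fun t => ridge α β j hf (l t) (θ t) := by
  refine ContinuousMap.continuous_of_continuous_uncurry _ ?_
  change Continuous fun p : ℝ × Icc α β => (p.2 : ℝ) ^ j * f (l p.1 * p.2 + θ p.1)
  fun_prop

theorem continuous_fwdDiff {f : ℝ → ℝ} (hf : Continuous f) (h : ℝ) : Continuous (fwdDiff h f) := by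
  unfold fwdDiff
  fun_prop

/-- Multiplication by `x` and differencing `f` preserve membership in a closed subspace:
differentiate `x ^ j * ∫ t in 0..h, f (l * x + θ + t)` with respect to `l`. -/
theorem ridge_succ_mem {α β : ℝ} {S : Submodule ℝ C(Icc α β, ℝ)}
    (hS : IsClosed (S : Set C(Icc α β, ℝ))) {j : ℕ} {f : ℝ → ℝ} (hf : Continuous f)
    (hmem : ∀ l θ, ridge α β j hf l θ ∈ S) (h l θ : ℝ) :
    ridge α β (j + 1) (continuous_fwdDiff hf h) l θ ∈ S := by
  let Φ : ℝ → ℝ := fun y => ∫ t in (0 : ℝ)..y, f t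
  have hΦ : ∀ y, HasDerivAt Φ (f y) y := fun y => (hf.integral_hasStrictDerivAt 0 y).hasDerivAt
  have hΦc : Continuous Φ := continuous_iff_continuousAt.2 fun y => (hΦ y).continuousAt
  -- `J μ` averages ridge functions of `f` over shifts in `[0, h]`. It stays in `S` and is
  -- differentiable in `μ` even when `f` is not differentiable.
  let J : ℝ → C(Icc α β, ℝ) := fun μ => ridge α β j (continuous_fwdDiff hΦc h) μ θ
  have hJmem : ∀ μ, J μ ∈ S := by
    intro μ
    have hcont : Continuous fun t => ridge α β j hf μ (θ + t) :=
      continuous_ridge j hf (by fun_prop) (by fun_prop)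
    have e : J μ = ∫ t in (0 : ℝ)..h, ridge α β j hf μ (θ + t) := by
      ext x
      have h1 := (ContinuousMap.evalCLM ℝ x).intervalIntegral_comp_comm
        (hcont.intervalIntegrable (μ := volume) 0 h)
      have h2 : (ContinuousMap.evalCLM ℝ x) (∫ t in (0 : ℝ)..h, ridge α β j hf μ (θ + t)) =
        (∫ t in (0 : ℝ)..h, ridge α β j hf μ (θ + t)) x := rfl
      rw [← h2, ← h1]
      have h3 : ∀ t ∈ uIcc 0 h, HasDerivAt (fun t => (x : ℝ) ^ j * Φ (μ * x + (θ + t)))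
          ((x : ℝ) ^ j * f (μ * x + (θ + t))) t := fun t _ => by
        have := (hΦ (μ * x + (θ + t))).comp t (((hasDerivAt_id t).const_add θ).const_add (μ * x))
        rw [mul_one] at this
        exact this.const_mul _
      have h4 := intervalIntegral.integral_eq_sub_of_hasDerivAt h3
        (Continuous.intervalIntegrable (by fun_prop) _ _)
      refine Eq.trans ?_ h4.symm
      simp only [J, ridge_apply, fwdDiff]
      rw [add_zero, add_assoc]
      ring
    rw [e]
    exact intervalIntegral_mem_of_isClosed hS hcont (fun t => hmem _ _) 0 h
  let R : ℝ → C(Icc α β, ℝ) := fun μ => ridge α β (j + 1) (continuous_fwdDiff hf h) μ θ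
  have hR : Continuous R := continuous_ridge _ _ continuous_id continuous_const
  -- Pointwise differentiation alone would not suffice: writing `J` as the integral of the
  -- continuous curve `R` gives the derivative in sup norm.
  have hJR : ∀ μ, J μ = J 0 + ∫ t in (0 : ℝ)..μ, R t := by
    intro μ
    ext x
    have h1 := (ContinuousMap.evalCLM ℝ x).intervalIntegral_comp_comm
      (hR.intervalIntegrable (μ := volume) 0 μ)
    have h2 : (ContinuousMap.evalCLM ℝ x) (∫ t in (0 : ℝ)..μ, R t) =
      (∫ t in (0 : ℝ)..μ, R t) x := rfl
    rw [ContinuousMap.add_apply, ← h2, ← h1]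
    have h3 : ∀ t ∈ uIcc 0 μ, HasDerivAt (fun t => J t x) (R t x) t := fun t _ => by
      have hin : HasDerivAt (fun t : ℝ => t * (x : ℝ) + θ) x t := by
        simpa using ((hasDerivAt_id t).mul_const (x : ℝ)).add_const θ
      have d1 := (hΦ (t * x + θ + h)).comp t (hin.add_const h)
      have d2 := (hΦ (t * x + θ)).comp t hin
      refine ((d1.sub d2).const_mul ((x : ℝ) ^ j)).congr_deriv ?_
      simp only [R, ridge_apply, fwdDiff]
      ring
    have h4 := intervalIntegral.integral_eq_sub_of_hasDerivAt h3
      (Continuous.intervalIntegrable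
        ((ContinuousMap.evalCLM ℝ x).continuous.comp hR) _ _)
    have h5 : (∫ t in (0 : ℝ)..μ, (ContinuousMap.evalCLM ℝ x) (R t)) = J μ x - J 0 x := h4
    rw [h5]
    ring
  have hderiv : HasDerivAt J (R l) l := by
    rw [show J = fun μ => J 0 + ∫ t in (0 : ℝ)..μ, R t from funext hJR]
    exact (hR.integral_hasStrictDerivAt 0 l).hasDerivAt.const_add _
  exact hasDerivAt_mem_of_isClosed hS hderiv hJmem

theorem continuous_fwdDiff_iter {f : ℝ → ℝ} (hf : Continuous f) (h : ℝ) (k : ℕ) :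
    Continuous ((fwdDiff h)^[k] f) := by
  induction k with
  | zero => exact hf
  | succ k ih =>
    rw [Function.iterate_succ_apply']
    exact continuous_fwdDiff ih h

/-- Each factor `x` costs one difference of `f`. At `l = 0` the result is a constant multiple of `x
^ k`. -/
theorem ridge_fwdDiff_iter_mem {α β : ℝ} {S : Submodule ℝ C(Icc α β, ℝ)}
    (hS : IsClosed (S : Set C(Icc α β, ℝ))) {f : ℝ → ℝ} (hf : Continuous f)
    (hmem : ∀ l θ, ridge α β 0 hf l θ ∈ S) (h : ℝ) (k : ℕ) (l θ : ℝ) :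
    ridge α β k (continuous_fwdDiff_iter hf h k) l θ ∈ S := by
  induction k generalizing l θ with
  | zero => exact hmem l θ
  | succ k ih =>
    have := ridge_succ_mem hS (continuous_fwdDiff_iter hf h k) ih h l θ
    convert this using 2
    rw [Function.iterate_succ_apply']

/-- A continuous function that is not a polynomial is a Tauber-Wiener function. -/
theorem isTauberWiener_of_not_polynomial {σ : ℝ → ℝ} (hσ : Continuous σ)
    (hp : ¬ ∃ p : Polynomial ℝ, ∀ x, σ x = p.eval x) : IsTauberWiener σ := by
  intro α β hαβ f hf ε hε
  let S₀ : Submodule ℝ C(Icc α β, ℝ) :=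
    Submodule.span ℝ (range fun p : ℝ × ℝ => ridge α β 0 hσ p.1 p.2)
  let S := S₀.topologicalClosure
  have hS : IsClosed (S : Set C(Icc α β, ℝ)) := S₀.isClosed_topologicalClosure
  have hmem : ∀ l θ, ridge α β 0 hσ l θ ∈ S := fun l θ =>
    S₀.le_topologicalClosure (Submodule.subset_span ⟨(l, θ), rfl⟩)
  have hmono : ∀ k : ℕ, ((Polynomial.X ^ k : Polynomial ℝ).toContinuousMapOn (Icc α β)) ∈ S := by
    intro k
    obtain ⟨h, hh⟩ : ∃ h, (fwdDiff h)^[k] σ ≠ 0 := by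
      by_contra! H
      exact hp (exists_polynomial_of_fwdDiff_iter_eq_zero hσ H)
    obtain ⟨θ, hθ⟩ := Function.ne_iff.1 hh
    -- With zero weight the ridge is `x ^ k` times the nonzero number `(fwdDiff h)^[k] σ θ`, which
    -- is divided out.
    have h1 := S.smul_mem ((fwdDiff h)^[k] σ θ)⁻¹ (ridge_fwdDiff_iter_mem hS hσ hmem h k 0 θ)
    convert h1 using 1
    ext x
    rw [ContinuousMap.smul_apply, ridge_apply, zero_mul, zero_add, smul_eq_mul]
    simp only [Polynomial.toContinuousMapOn_apply, Polynomial.toContinuousMap_apply,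
      Polynomial.eval_pow, Polynomial.eval_X]
    have hθ' : (fwdDiff h)^[k] σ θ ≠ 0 := hθ
    field_simp
  have hpoly : ∀ p : Polynomial ℝ, p.toContinuousMapOn (Icc α β) ∈ S := by
    intro p
    have e : p.toContinuousMapOn (Icc α β) =
        ∑ k ∈ p.support, p.coeff k • (Polynomial.X ^ k : Polynomial ℝ).toContinuousMapOn _ := by
      ext x
      simp [Polynomial.eval_eq_sum, Polynomial.sum, ContinuousMap.sum_apply]
    rw [e]
    exact S.sum_mem fun k _ => S.smul_mem _ (hmono k)
  let F : C(Icc α β, ℝ) := ⟨fun x => f x, hf.domRestrict⟩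
  have hF : F ∈ S := by
    -- Weierstrass's theorem.
    have h1 : F ∈ (polynomialFunctions (Icc α β)).topologicalClosure := by
      rw [polynomialFunctions_closure_eq_top]
      trivial
    rw [← SetLike.mem_coe, Subalgebra.topologicalClosure_coe] at h1
    refine closure_minimal ?_ hS h1
    rw [polynomialFunctions_coe]
    rintro _ ⟨p, rfl⟩
    exact hpoly p
  obtain ⟨s, hs, hFs⟩ := Metric.mem_closure_iff.1 hF ε hε
  obtain ⟨n, c, p, rfl⟩ := Submodule.mem_span_set'.1 hs
  choose q hq using fun i => (p i).2
  refine ⟨n, c, fun i => (q i).1, fun i => (q i).2, fun x hx => ?_⟩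
  have h1 := (ContinuousMap.dist_apply_le_dist (f := F) (g := ∑ i, c i • (p i : C(Icc α β, ℝ)))
    ⟨x, hx⟩).trans_lt hFs
  rw [Real.dist_eq, ContinuousMap.sum_apply] at h1
  refine lt_of_eq_of_lt ?_ h1
  congr 2
  refine Finset.sum_congr rfl fun i _ => ?_
  rw [← hq, ContinuousMap.smul_apply, ridge_apply, pow_zero, one_mul, smul_eq_mul]

/-! ### Universal approximation in several variables. -/

/-- The linear combinations, with coefficients in `F`, of the ridge functions
`x ↦ σ (w ⬝ᵥ x + θ)`. -/
def ridgeSpan (σ : ℝ → ℝ) (p : ℕ) (F : Type*) [AddCommGroup F] [Module ℝ F] :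
    Submodule ℝ ((Fin p → ℝ) → F) :=
  Submodule.span ℝ (range fun q : (Fin p → ℝ) × ℝ × F => fun x => σ (q.1 ⬝ᵥ x + q.2.1) • q.2.2)

/-- The exponentials of linear forms span a dense subspace of `C(E, ℝ)`. -/
theorem exists_sum_exp_near {p : ℕ} (E : Set (Fin p → ℝ)) [CompactSpace E] (f : C(E, ℝ)) {ε : ℝ}
    (hε : 0 < ε) : ∃ (n : ℕ) (c : Fin n → ℝ) (w : Fin n → Fin p → ℝ),
      ∀ x : E, |f x - ∑ i, c i * Real.exp (w i ⬝ᵥ x)| < ε := by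
  let e : (Fin p → ℝ) → C(E, ℝ) := fun w =>
    ⟨fun x => Real.exp (w ⬝ᵥ x), by
      have : Continuous fun x : E => w ⬝ᵥ (x : Fin p → ℝ) :=
        continuous_const.dotProduct continuous_subtype_val
      fun_prop⟩
  let A : Subalgebra ℝ C(E, ℝ) := Algebra.adjoin ℝ (range e)
  have hsep : A.SeparatesPoints := by
    intro x y hxy
    obtain ⟨i, hi⟩ : ∃ i, (x : Fin p → ℝ) i ≠ (y : Fin p → ℝ) i := by
      by_contra! H
      exact hxy (Subtype.ext (funext H))
    refine ⟨e (Pi.single i 1), ⟨_, Algebra.subset_adjoin ⟨_, rfl⟩, rfl⟩, fun h => hi ?_⟩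
    have h' : Real.exp (Pi.single i 1 ⬝ᵥ (x : Fin p → ℝ)) =
      Real.exp (Pi.single i 1 ⬝ᵥ (y : Fin p → ℝ)) := h
    simpa using h'
  -- Products of exponentials of linear forms are again such exponentials, so the generated algebra
  -- is only their linear span.
  have hclos : (Submonoid.closure (range e) : Set C(E, ℝ)) ⊆ range e := by
    let M : Submonoid C(E, ℝ) :=
      { carrier := range e
        one_mem' := ⟨0, by ext x; simp [e]⟩
        mul_mem' := by
          rintro _ _ ⟨v, rfl⟩ ⟨w, rfl⟩
          exact ⟨v + w, by ext x; simp [e, add_dotProduct, Real.exp_add]⟩ }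
    exact (Submonoid.closure_le (S := M)).2 subset_rfl
  have hf : f ∈ A.topologicalClosure := by
    rw [ContinuousMap.subalgebra_topologicalClosure_eq_top_of_separatesPoints A hsep]
    trivial
  rw [← SetLike.mem_coe, Subalgebra.topologicalClosure_coe] at hf
  obtain ⟨s, hs, hfs⟩ := Metric.mem_closure_iff.1 hf ε hε
  have hs' : s ∈ Submodule.span ℝ (range e) := by
    have h1 : s ∈ Subalgebra.toSubmodule A := hs
    rw [Algebra.adjoin_eq_span] at h1
    exact Submodule.span_mono hclos h1
  obtain ⟨n, c, q, rfl⟩ := Submodule.mem_span_set'.1 hs'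
  choose w hw using fun i => (q i).2
  refine ⟨n, c, w, fun x => ?_⟩
  have h1 := (ContinuousMap.dist_apply_le_dist (f := f) (g := ∑ i, c i • (q i : C(E, ℝ)))
    x).trans_lt hfs
  rw [Real.dist_eq, ContinuousMap.sum_apply] at h1
  refine lt_of_eq_of_lt ?_ h1
  congr 2
  refine Finset.sum_congr rfl fun i _ => ?_
  rw [← hw, ContinuousMap.smul_apply, smul_eq_mul]
  rfl

/-- The form `w ⬝ᵥ x` takes values in a bounded interval, where `exp` is a one-variable
approximation problem; composing with the form turns `σ (l t + θ)` into a ridge function of weight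
`l • w`. -/
theorem exists_ridgeSpan_near_exp {σ : ℝ → ℝ} (hσ : IsTauberWiener σ) {p : ℕ}
    {E : Set (Fin p → ℝ)} (hE : IsCompact E) (w : Fin p → ℝ) {ε : ℝ} (hε : 0 < ε) :
    ∃ r ∈ ridgeSpan σ p ℝ, ∀ x ∈ E, |Real.exp (w ⬝ᵥ x) - r x| < ε := by
  have hc : Continuous fun x : Fin p → ℝ => w ⬝ᵥ x := continuous_const.dotProduct continuous_id
  obtain ⟨R, hR⟩ := (hE.image hc).isBounded.exists_norm_le
  -- The radius `|R| + 1` keeps the interval nondegenerate; `R` can be negative when `E` is empty.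
  have hR' : ∀ x ∈ E, w ⬝ᵥ x ∈ Icc (-(|R| + 1)) (|R| + 1) := fun x hx => by
    have := (hR _ (mem_image_of_mem _ hx)).trans (le_abs_self R)
    rw [Real.norm_eq_abs, abs_le] at this
    constructor <;> linarith
  obtain ⟨n, c, l, θ, H⟩ := hσ (-(|R| + 1)) (|R| + 1) (by linarith [abs_nonneg R]) Real.exp
    Real.continuous_exp.continuousOn ε hε
  refine ⟨∑ i, c i • fun x => σ ((l i • w) ⬝ᵥ x + θ i) • (1 : ℝ), ?_, fun x hx => ?_⟩
  · exact Submodule.sum_mem _ fun i _ => Submodule.smul_mem _ _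
      (Submodule.subset_span ⟨(l i • w, θ i, 1), rfl⟩)
  · convert H _ (hR' x hx) using 3
    simp [Finset.sum_apply, smul_dotProduct]

theorem exists_ridgeSpan_near {σ : ℝ → ℝ} (hσ : IsTauberWiener σ) {p : ℕ}
    {E : Set (Fin p → ℝ)} (hE : IsCompact E) {f : (Fin p → ℝ) → ℝ} (hf : ContinuousOn f E)
    {ε : ℝ} (hε : 0 < ε) :
    ∃ r ∈ ridgeSpan σ p ℝ, ∀ x ∈ E, |f x - r x| < ε := by
  have : CompactSpace E := isCompact_iff_compactSpace.1 hE
  obtain ⟨n, c, w, H⟩ := exists_sum_exp_near E ⟨E.domRestrict f, hf.domRestrict⟩ (half_pos hε)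
  -- The `1` keeps `C` positive when all coefficients vanish.
  let C : ℝ := ∑ i, |c i| + 1
  have hC : 0 < C := by positivity
  choose r hr hrx using fun i => exists_ridgeSpan_near_exp hσ hE (w i)
    (div_pos (half_pos hε) hC)
  refine ⟨∑ i, c i • r i, Submodule.sum_mem _ fun i _ => Submodule.smul_mem _ _ (hr i),
    fun x hx => ?_⟩
  have h1 : |f x - ∑ i, c i * Real.exp (w i ⬝ᵥ x)| < ε / 2 := H ⟨x, hx⟩
  have h2 : |∑ i, c i * Real.exp (w i ⬝ᵥ x) - (∑ i, c i • r i) x| ≤ ε / 2 := by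
    rw [Finset.sum_apply, ← Finset.sum_sub_distrib]
    calc _ ≤ ∑ i, |c i * Real.exp (w i ⬝ᵥ x) - (c i • r i) x| :=
          Finset.abs_sum_le_sum_abs _ _
      _ ≤ ∑ i, |c i| * (ε / 2 / C) := by
          refine Finset.sum_le_sum fun i _ => ?_
          rw [Pi.smul_apply, smul_eq_mul, ← mul_sub, abs_mul]
          exact mul_le_mul_of_nonneg_left (hrx i x hx).le (abs_nonneg _)
      _ = (∑ i, |c i|) * (ε / 2 / C) := (Finset.sum_mul _ _ _).symm
      _ ≤ C * (ε / 2 / C) := by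
          refine mul_le_mul_of_nonneg_right ?_ (by positivity)
          simp [C]
      _ = ε / 2 := mul_div_cancel₀ _ hC.ne'
  exact (abs_sub_le _ _ _).trans_lt (by linarith)

theorem exists_ridgeSpan_near_vector {σ : ℝ → ℝ} (hσ : IsTauberWiener σ) {p K : ℕ}
    {E : Set (Fin p → ℝ)} (hE : IsCompact E) {f : (Fin p → ℝ) → EuclideanSpace ℝ (Fin K)}
    (hf : ContinuousOn f E) {ε : ℝ} (hε : 0 < ε) :
    ∃ r ∈ ridgeSpan σ p (EuclideanSpace ℝ (Fin K)), ∀ x ∈ E, ‖f x - r x‖ < ε := by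
  have hK : (0 : ℝ) < K + 1 := by positivity
  have hfk : ∀ k, ContinuousOn (fun x => f x k) E := fun k =>
    (EuclideanSpace.proj (𝕜 := ℝ) k).continuous.comp_continuousOn hf
  -- The tolerance `ε / (K + 1)` per coordinate leaves a strict inequality after summing, also for
  -- `K = 0`.
  choose r hr hrx using fun k => exists_ridgeSpan_near hσ hE (hfk k) (div_pos hε hK)
  let b := EuclideanSpace.basisFun (Fin K) ℝ
  have hmem : ∀ k, (fun x => r k x • b k) ∈ ridgeSpan σ p (EuclideanSpace ℝ (Fin K)) := by
    intro k
    let T : ((Fin p → ℝ) → ℝ) →ₗ[ℝ] ((Fin p → ℝ) → EuclideanSpace ℝ (Fin K)) :=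
      { toFun := fun g x => g x • b k
        map_add' := fun g h => funext fun x => add_smul _ _ _
        map_smul' := fun c g => funext fun x => mul_smul c (g x) (b k) }
    have hT : ridgeSpan σ p ℝ ≤ (ridgeSpan σ p (EuclideanSpace ℝ (Fin K))).comap T := by
      refine Submodule.span_le.2 ?_
      rintro _ ⟨q, rfl⟩
      refine Submodule.subset_span ⟨(q.1, q.2.1, q.2.2 • b k), ?_⟩
      exact funext fun x => (smul_assoc _ _ _).symm
    exact hT (hr k)
  refine ⟨∑ k, fun x => r k x • b k, Submodule.sum_mem _ fun k _ => hmem k, fun x hx => ?_⟩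
  have e : f x - (∑ k, fun x => r k x • b k) x = ∑ k, (f x k - r k x) • b k := by
    rw [Finset.sum_apply]
    simp only [sub_smul, Finset.sum_sub_distrib]
    congr 1
    exact (b.sum_repr (f x)).symm
  rw [e]
  calc ‖∑ k, (f x k - r k x) • b k‖ ≤ ∑ k, ‖(f x k - r k x) • b k‖ := norm_sum_le _ _
    _ ≤ ∑ _k : Fin K, ε / (K + 1) := by
        refine Finset.sum_le_sum fun k _ => ?_
        rw [norm_smul, b.orthonormal.1 k, mul_one]
        exact (hrx k x hx).le
    _ = K * (ε / (K + 1)) := by simp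
    _ < (K + 1) * (ε / (K + 1)) := by
        refine mul_lt_mul_of_pos_right (by linarith) (by positivity)
    _ = ε := mul_div_cancel₀ _ hK.ne'

theorem exists_network_eq {σ : ℝ → ℝ} {p K : ℕ}
    {r : (Fin p → ℝ) → EuclideanSpace ℝ (Fin K)}
    (hr : r ∈ ridgeSpan σ p (EuclideanSpace ℝ (Fin K))) :
    ∃ (n : ℕ) (W₁ : Matrix (Fin n) (Fin p) ℝ) (b₁ : Fin n → ℝ) (W₂ : Matrix (Fin K) (Fin n) ℝ)
      (b₂ : Fin K → ℝ), 0 < n ∧ ∀ x, r x = network σ W₁ b₁ W₂ b₂ x := by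
  obtain ⟨n, c, q, rfl⟩ := Submodule.mem_span_set'.1 hr
  choose z hz using fun i => (q i).2
  -- An idle neuron with zero weights ensures a positive width even if the linear combination is
  -- empty.
  refine ⟨n + 1, Matrix.of (Fin.cons 0 fun i => (z i).1), Fin.cons 0 fun i => (z i).2.1,
    Matrix.of fun k => Fin.cons 0 fun i => c i * (z i).2.2 k, 0, Nat.succ_pos n, fun x => ?_⟩
  ext k
  rw [Finset.sum_apply]
  simp only [network, add_zero, Matrix.mulVec, dotProduct, Fin.sum_univ_succ, Matrix.of_apply,
    Fin.cons_zero, Fin.cons_succ, zero_mul, zero_add, Pi.add_apply]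
  rw [WithLp.ofLp_sum, Finset.sum_apply]
  refine Finset.sum_congr rfl fun i _ => ?_
  rw [Pi.smul_apply, ← hz]
  simp only [PiLp.smul_apply, smul_eq_mul, dotProduct]
  ring

/-- The universal approximation theorem for networks with one hidden layer. -/
theorem exists_network_near {σ : ℝ → ℝ} (hσ : IsTauberWiener σ) {p K : ℕ}
    {E : Set (Fin p → ℝ)} (hE : IsCompact E) {f : (Fin p → ℝ) → EuclideanSpace ℝ (Fin K)}
    (hf : ContinuousOn f E) {ε : ℝ} (hε : 0 < ε) :
    ∃ (n : ℕ) (W₁ : Matrix (Fin n) (Fin p) ℝ) (b₁ : Fin n → ℝ) (W₂ : Matrix (Fin K) (Fin n) ℝ)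
      (b₂ : Fin K → ℝ), 0 < n ∧ ∀ x ∈ E, ‖f x - network σ W₁ b₁ W₂ b₂ x‖ < ε := by
  obtain ⟨r, hr, H⟩ := exists_ridgeSpan_near_vector hσ hE hf hε
  obtain ⟨n, W₁, b₁, W₂, b₂, hn, e⟩ := exists_network_eq hr
  exact ⟨n, W₁, b₁, W₂, b₂, hn, fun x hx => e x ▸ H x hx⟩

end SensorODE

/-! ### The main theorem. -/

theorem theorem2
    {a b : ℝ} (hab : a < b)
    -- the compact set of inputs
    (V : Set C(Icc a b, ℝ)) (hV : IsCompact V)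
    -- the right-hand side, the initial value, and the solution operator on `W`
    (K : ℕ) (g : EuclideanSpace ℝ (Fin K) → ℝ → ℝ → EuclideanSpace ℝ (Fin K))
    (s₀ : EuclideanSpace ℝ (Fin K))
    (G : C(Icc a b, ℝ) → C(Icc a b, EuclideanSpace ℝ (Fin K)))
    (hG : ∀ w ∈ SensorODE.extendedInputs hab V, SensorODE.IsSolution hab g s₀ w (G w))
    -- the Lipschitz condition in `s` and in `u` on `G(W) × W`
    (c : ℝ) (hc : 0 < c)
    (hLs : ∀ s₁ ∈ G '' SensorODE.extendedInputs hab V,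
      ∀ s₂ ∈ G '' SensorODE.extendedInputs hab V,
      ∀ w ∈ SensorODE.extendedInputs hab V, ∀ x : Icc a b,
        ‖g (s₁ x) (w x) x - g (s₂ x) (w x) x‖ ≤ c * ‖s₁ x - s₂ x‖)
    (hLu : ∀ s ∈ G '' SensorODE.extendedInputs hab V,
      ∀ w₁ ∈ SensorODE.extendedInputs hab V,
      ∀ w₂ ∈ SensorODE.extendedInputs hab V, ∀ x : Icc a b,
        ‖g (s x) (w₁ x) x - g (s x) (w₂ x) x‖ ≤ c * |w₁ x - w₂ x|)
    -- the activation function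
    (σ : ℝ → ℝ)
    (hσ : (Continuous σ ∧ ¬ ∃ p : Polynomial ℝ, ∀ x, σ x = p.eval x) ∨
      SensorODE.IsTauberWiener σ) :
    (∀ m : ℕ, 0 < m → ∀ u ∈ V, ∀ x : Icc a b,
      |u x - SensorODE.interp hab m u x| ≤ SensorODE.kappa hab V m) ∧
    Tendsto (SensorODE.kappa hab V) atTop (𝓝 0) ∧
    ∀ (ε : ℝ) (m : ℕ), 0 < m →
      c * (b - a) * SensorODE.kappa hab V m * Real.exp (c * (b - a)) < ε →
      ∀ d : Icc a b,
        ∃ (n : ℕ) (W₁ : Matrix (Fin n) (Fin (m + 1)) ℝ) (b₁ : Fin n → ℝ)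
          (W₂ : Matrix (Fin K) (Fin n) ℝ) (b₂ : Fin K → ℝ), 0 < n ∧
          ∀ u ∈ V,
            ‖G u d - SensorODE.network σ W₁ b₁ W₂ b₂ (fun j => u (SensorODE.node hab m j))‖
              < ε := by
  have hVW : ∀ u ∈ V, u ∈ SensorODE.extendedInputs hab V := fun u hu =>
    mem_iUnion₂.2 ⟨1, le_rfl, Or.inl hu⟩
  have hIW : ∀ m : ℕ, 0 < m → ∀ u ∈ V,
      SensorODE.interp hab m u ∈ SensorODE.extendedInputs hab V := fun m hm u hu =>
    mem_iUnion₂.2 ⟨m, hm, Or.inr (mem_image_of_mem _ hu)⟩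
  have hstab : ∀ w₁ ∈ SensorODE.extendedInputs hab V, ∀ w₂ ∈ SensorODE.extendedInputs hab V,
      ∀ d, ‖G w₁ d - G w₂ d‖ ≤ c * (b - a) * ‖w₁ - w₂‖ * Real.exp (c * (b - a)) :=
    fun w₁ h₁ w₂ h₂ d => SensorODE.norm_solution_sub_solution_le hab (hG w₁ h₁) (hG w₂ h₂) hc
      (hLs _ (mem_image_of_mem G h₁) _ (mem_image_of_mem G h₂) w₁ h₁)
      (hLu _ (mem_image_of_mem G h₂) w₁ h₁ w₂ h₂) d
  have hTW : SensorODE.IsTauberWiener σ :=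
    hσ.elim (fun h => SensorODE.isTauberWiener_of_not_polynomial h.1 h.2) id
  have hcba : 0 ≤ c * (b - a) := mul_nonneg hc.le (by linarith)
  refine ⟨fun m hm u hu x => ?_, SensorODE.tendsto_kappa hab hV, fun ε m hm hlt d => ?_⟩
  · exact ((u - SensorODE.interp hab m u).norm_coe_le_norm x).trans
      (SensorODE.norm_sub_interp_le_kappa hab hV hm hu)
  · set δ := c * (b - a) * SensorODE.kappa hab V m * Real.exp (c * (b - a)) with hδ
    let S : C(Icc a b, ℝ) → Fin (m + 1) → ℝ := fun u j => u (SensorODE.node hab m j)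
    have hS : Continuous S := by fun_prop
    -- For a sensor vector `y` from `V`, any input in `V` with these values serves: its interpolant,
    -- hence `φ y`, does not depend on the choice.
    let φ : (Fin (m + 1) → ℝ) → EuclideanSpace ℝ (Fin K) := fun y =>
      G (SensorODE.interp hab m (Function.invFunOn S V y)) d
    have hinv : ∀ u ∈ V, Function.invFunOn S V (S u) ∈ V ∧ S (Function.invFunOn S V (S u)) = S u :=
      fun u hu =>
      Function.invFunOn_pos ⟨u, hu, rfl⟩
    have hφ : ∀ u ∈ V, φ (S u) = G (SensorODE.interp hab m u) d := by
      intro u hu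
      have h0 := SensorODE.norm_interp_sub_interp_le hab hm (Function.invFunOn S V (S u)) u (r := 0)
        fun j => by
          have := congrFun (hinv u hu).2 j
          simp only [S] at this
          rw [this, sub_self, abs_zero]
      have h1 := sub_eq_zero.1 (norm_le_zero_iff.1 h0)
      simp only [φ, h1]
    -- Interpolation is nonexpansive in the sensor values and `G` is Lipschitz on `W`, which
    -- contains the interpolants.
    have hcont : ContinuousOn φ (S '' V) := by
      refine (LipschitzOnWith.of_dist_le_mul
        (K := Real.toNNReal (c * (b - a) * Real.exp (c * (b - a)))) ?_).continuousOn
      rintro _ ⟨u, hu, rfl⟩ _ ⟨v, hv, rfl⟩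
      rw [hφ u hu, hφ v hv, dist_eq_norm, Real.coe_toNNReal _ (by positivity)]
      refine (hstab _ (hIW m hm u hu) _ (hIW m hm v hv) d).trans ?_
      have h1 := SensorODE.norm_interp_sub_interp_le hab hm u v (r := dist (S u) (S v))
        fun j => dist_le_pi_dist (S u) (S v) j
      rw [mul_right_comm]
      exact mul_le_mul_of_nonneg_left h1 (by positivity)
    -- Interpolation uses up at most `δ`, leaving `ε - δ` for the network.
    obtain ⟨n, W₁, b₁, W₂, b₂, hn, H⟩ := SensorODE.exists_network_near hTW (hV.image hS) hcont
      (sub_pos.2 hlt)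
    refine ⟨n, W₁, b₁, W₂, b₂, hn, fun u hu => ?_⟩
    have h1 := H _ (mem_image_of_mem S hu)
    rw [hφ u hu] at h1
    have h2 : ‖G u d - G (SensorODE.interp hab m u) d‖ ≤ δ := by
      refine (hstab u (hVW u hu) _ (hIW m hm u hu) d).trans ?_
      have := SensorODE.norm_sub_interp_le_kappa hab hV hm hu
      rw [hδ]
      gcongr
    calc _ ≤ _ + _ := norm_sub_le_norm_sub_add_norm_sub _ (G (SensorODE.interp hab m u) d) _
      _ < ε := by
        have h3 : ‖G (SensorODE.interp hab m u) d - SensorODE.network σ W₁ b₁ W₂ b₂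
            (fun j => u (SensorODE.node hab m j))‖ < ε - δ := h1
        linarith
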